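/- For $n,m\in\mathbb{N}=\{0,1,2,\dots\}$ let $cp_2(n,m)$ be the number of partitions of $n$ into $m$ (positive) parts, listed in non-decreasing order, such that no part equals $2$, successive parts differ by at least $2$, and two successive parts differ by at least $4$ unless their sum is a multiple of $3$. For $k\ge 0$ put $(a;b)_k=\prod_{j=1}^{k}(1-ab^{j-1})$. Then, as an identity of formal power series in $q$ and $x$, $$\sum_{m,n\ge 0} cp_2(n,m)\,q^n x^m=\sum_{n_1,n_2\ge 0}\frac{q^{6n_2^2+3n_2+2n_1^2+n_1+6n_2n_1}\,\bigl(1+xq^{3n_2+2n_1+1}\bigr)\,x^{2n_2+n_1}}{(q;q)_{n_1}\,(q^3;q^3)_{n_2}}.$$ Moreover, the two terms of the factor $1+xq^{3n_2+2n_1+1}$ correspond to whether the part $1$ occurs: replacing this factor by $1$ gives the generating function of those partitions counted by $cp_2(n,m)$ in which the part $1$ does not occur, and replacing it by $xq^{3n_2+2n_1+1}$ gives the generating function of those in which the part $1$ occurs. -/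

import Mathlib

namespace Capparelli

/-- The Capparelli condition on two successive parts `a ≤ b` of a partition: their difference is
at least two, and it is at least four unless `a + b` is a multiple of three. -/
abbrev GapCondition (a b : ℕ) : Prop :=
  a + 2 ≤ b ∧ (¬ 3 ∣ a + b → a + 4 ≤ b)

/-- The partitions of `n` into `m` parts with no part equal to two, all of whose successive parts
(the parts being listed in non-decreasing order) satisfy the Capparelli condition. -/
def partitions₂ (n m : ℕ) : Finset n.Partition :=
  {p : n.Partition | p.parts.card = m ∧ 2 ∉ p.parts ∧
    (p.parts.sort (· ≤ ·)).IsChain GapCondition}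

/-- The number of partitions in `partitions₂ n m`. -/
def cp₂ (n m : ℕ) : ℕ := (partitions₂ n m).card

/-- The number of partitions in `partitions₂ n m` in which the part one does not occur. -/
def cp₂WithoutOne (n m : ℕ) : ℕ := {p ∈ partitions₂ n m | 1 ∉ p.parts}.card

/-- The number of partitions in `partitions₂ n m` in which the part one occurs. -/
def cp₂WithOne (n m : ℕ) : ℕ := {p ∈ partitions₂ n m | 1 ∈ p.parts}.card

/-- The indeterminate `q` of the ring `ℤ⟦q, x⟧`. -/
noncomputable def q : MvPowerSeries (Fin 2) ℤ := MvPowerSeries.X 0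

/-- The indeterminate `x` of the ring `ℤ⟦q, x⟧`. -/
noncomputable def x : MvPowerSeries (Fin 2) ℤ := MvPowerSeries.X 1

/-- The formal power series `∑_{m, n ≥ 0} c(n, m) q ^ n x ^ m`, given by its coefficients. -/
def genFun (c : ℕ → ℕ → ℕ) : MvPowerSeries (Fin 2) ℤ := fun d => (c (d 0) (d 1) : ℤ)

/-- The `q`-Pochhammer symbol `(a; b)_n = ∏_{j = 1}^{n} (1 - a b ^ (j - 1))`. -/
def qPochhammer {R : Type*} [CommRing R] (a b : R) (n : ℕ) : R :=
  ∏ j ∈ Finset.range n, (1 - a * b ^ j)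

/-- The common denominator `(q; q)_{n₁} (q³; q³)_{n₂}`. -/
noncomputable def denom (n₁ n₂ : ℕ) : MvPowerSeries (Fin 2) ℤ :=
  qPochhammer q q n₁ * qPochhammer (q ^ 3) (q ^ 3) n₂

/-- The denominators are invertible in `ℤ⟦q, x⟧`, so that `Ring.inverse` is their inverse. -/
theorem isUnit_denom (n₁ n₂ : ℕ) : IsUnit (denom n₁ n₂) := by
  rw [MvPowerSeries.isUnit_iff_constantCoeff]
  simp [denom, qPochhammer, q, map_prod]

/-- The quotient of a formal power series by `(q; q)_{n₁} (q³; q³)_{n₂}`. -/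
noncomputable def overDenom (f : MvPowerSeries (Fin 2) ℤ) (n₁ n₂ : ℕ) :
    MvPowerSeries (Fin 2) ℤ :=
  f * Ring.inverse (denom n₁ n₂)

end Capparelli

/- Infinite sums of formal power series are taken coefficientwise: the topology on `ℤ⟦q, x⟧` is the
product topology of the discrete topologies on the coefficients. -/
open scoped MvPowerSeries.WithPiTopology
open Capparelli

namespace Capparelli

open MvPowerSeries

/-! Let G(s) be the generating function of the gap lists with first part at least s. Splitting on
the first part gives a coupled system for B_k = G(3k+2) and C_k = G(3k+3)
(`listGenFun_gapLists_two_mod`, `listGenFun_gapLists_zero_mod`). Let S(a,b) be the double series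
with linear exponent a n₂ + b n₁. Then S(6k,3k) and S(6k+3,3k+1) solve the same system
(`doubleSeries_two_mod`, `doubleSeries_zero_mod`). A solution with B_k ≡ 1 modulo q^k is unique
(`eq_zero_of_q_difference`), so the two agree. Partitions without the part 1 give C_0 = S(3,1).
Those with it continue with a part at least 5 and give xq B_1 = xq S(6,3). -/

/-! ### Generating functions of sets of lists -/

/-- The members of `L` with sum `n` and length `m`. -/
def listFiber (L : Set (List ℕ)) (n m : ℕ) : Set (List ℕ) :=
  {l | l ∈ L ∧ l.sum = n ∧ l.length = m}

/-- The generating function of a set of lists by sum and length. -/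
noncomputable def listGenFun (L : Set (List ℕ)) : MvPowerSeries (Fin 2) ℤ :=
  genFun fun n m => (listFiber L n m).ncard

theorem coeff_genFun (c : ℕ → ℕ → ℕ) (d : Fin 2 →₀ ℕ) :
    coeff d (genFun c) = (c (d 0) (d 1) : ℤ) := rfl

/-- Needed because `Set.ncard` of an infinite set is 0. Zero entries are allowed, but the fixed
length still bounds the number of lists. -/
theorem finite_listFiber (L : Set (List ℕ)) (n m : ℕ) : (listFiber L n m).Finite := by
  refine ((List.finite_length_eq (Fin (n + 1)) m).image (List.map Fin.val)).subset ?_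
  rintro l ⟨-, hs, hl⟩
  have hle : ∀ a ∈ l, a < n + 1 := fun a ha =>
    Nat.lt_succ_of_le (hs ▸ List.single_le_sum (fun _ _ => Nat.zero_le _) a ha)
  refine ⟨l.pmap (fun a h => (⟨a, h⟩ : Fin (n + 1))) hle, by simpa using hl, ?_⟩
  simp [List.map_pmap]

theorem listGenFun_union {L M : Set (List ℕ)} (h : Disjoint L M) :
    listGenFun (L ∪ M) = listGenFun L + listGenFun M := by
  ext d
  rw [map_add, listGenFun, listGenFun, listGenFun, coeff_genFun, coeff_genFun, coeff_genFun,
    ← Nat.cast_add, ← Set.ncard_union_eq _ (finite_listFiber _ _ _) (finite_listFiber _ _ _)]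
  · congr 2
    ext l
    simp only [listFiber, Set.mem_union, Set.mem_ofPred_eq]
    tauto
  · exact Set.disjoint_left.2 fun l hl hm => Set.disjoint_left.1 h hl.1 hm.1

theorem x_mul_q_pow (s : ℕ) :
    x * q ^ s = monomial (Finsupp.single 1 1 + Finsupp.single 0 s) (1 : ℤ) := by
  rw [x, q, X_pow_eq, X, monomial_mul_monomial, one_mul]

theorem listGenFun_cons_image (s : ℕ) (L : Set (List ℕ)) :
    listGenFun (List.cons s '' L) = x * q ^ s * listGenFun L := by
  ext d
  rw [x_mul_q_pow, coeff_monomial_mul, listGenFun, listGenFun, coeff_genFun, coeff_genFun, one_mul]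
  have hd : Finsupp.single 1 1 + Finsupp.single 0 s ≤ d ↔ s ≤ d 0 ∧ 1 ≤ d 1 := by
    rw [Finsupp.le_def, Fin.forall_fin_two]
    simp
  split_ifs with h
  · rw [hd] at h
    rw [← Set.ncard_image_of_injective (listFiber L _ _) (List.cons_injective (a := s))]
    congr 2
    ext l
    simp only [listFiber, Set.mem_image, Set.mem_ofPred_eq, Finsupp.coe_tsub, Finsupp.coe_add,
      Pi.sub_apply, Pi.add_apply]
    constructor
    · rintro ⟨⟨t, ht, rfl⟩, h1, h2⟩
      simp only [List.sum_cons, List.length_cons] at h1 h2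
      exact ⟨t, ⟨ht, by simp; omega, by simp; omega⟩, rfl⟩
    · rintro ⟨t, ⟨ht, h1, h2⟩, rfl⟩
      simp at h1 h2
      exact ⟨⟨t, ht, rfl⟩, by simp; omega, by simp; omega⟩
  · rw [hd] at h
    rw [Nat.cast_eq_zero, Set.ncard_eq_zero (finite_listFiber _ _ _)]
    refine Set.eq_empty_of_forall_notMem ?_
    rintro _ ⟨⟨t, ht, rfl⟩, h1, h2⟩
    simp only [List.sum_cons, List.length_cons] at h1 h2
    omega

/-! ### Lists satisfying the gap condition -/

/-- The lists whose successive entries satisfy `GapCondition`, with first entry at least `s`. -/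
def gapLists (s : ℕ) : Set (List ℕ) :=
  {l | l.IsChain GapCondition ∧ ∀ a ∈ l.head?, s ≤ a}

theorem nil_mem_gapLists (s : ℕ) : [] ∈ gapLists s := by simp [gapLists]

theorem cons_mem_gapLists {s a : ℕ} {l : List ℕ} :
    a :: l ∈ gapLists s ↔ s ≤ a ∧ (a :: l).IsChain GapCondition := by
  simp [gapLists, and_comm]

theorem disjoint_gapLists_cons_image {s t : ℕ} (h : s < t) (L : Set (List ℕ)) :
    Disjoint (gapLists t) (List.cons s '' L) := by
  refine Set.disjoint_left.2 ?_
  rintro _ hl ⟨l, -, rfl⟩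
  have := (cons_mem_gapLists.1 hl).1
  omega

theorem gapLists_eq_union (s : ℕ) :
    gapLists s = gapLists (s + 1) ∪ List.cons s '' {l | (s :: l).IsChain GapCondition} := by
  ext l
  cases l with
  | nil => simp [nil_mem_gapLists]
  | cons a l =>
    simp only [Set.mem_union, cons_mem_gapLists, Set.mem_image, Set.mem_ofPred_eq, List.cons.injEq]
    constructor
    · rintro ⟨h, hl⟩
      rcases h.eq_or_lt with rfl | h
      · exact Or.inr ⟨l, hl, rfl, rfl⟩
      · exact Or.inl ⟨h, hl⟩
    · rintro (⟨h, hl⟩ | ⟨t, ht, rfl, rfl⟩)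
      · exact ⟨by omega, hl⟩
      · exact ⟨le_rfl, ht⟩

/-- Differences 2 and 3 are allowed only when 3 divides 2s+2 or 2s+3, that is, for s ≡ 2 or s ≡ 0
mod 3 respectively. So only s ≡ 2 leaves a hole, at s+3, in the admissible successors. -/
theorem tails_of_forall_iff {s t : ℕ} (h : ∀ b, GapCondition s b ↔ t ≤ b) :
    {l | (s :: l).IsChain GapCondition} = gapLists t := by
  ext l
  cases l with
  | nil => simp [nil_mem_gapLists]
  | cons a l => simp [cons_mem_gapLists, List.isChain_cons_cons, h]

theorem tails_zero_mod (k : ℕ) :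
    {l | ((3 * k + 3) :: l).IsChain GapCondition} = gapLists (3 * k + 6) :=
  tails_of_forall_iff fun b => by unfold GapCondition; omega

theorem tails_one_mod (k : ℕ) :
    {l | ((3 * k + 1) :: l).IsChain GapCondition} = gapLists (3 * k + 5) :=
  tails_of_forall_iff fun b => by unfold GapCondition; omega

theorem tails_two_mod (k : ℕ) :
    {l | ((3 * k + 2) :: l).IsChain GapCondition} =
      gapLists (3 * k + 6) ∪ List.cons (3 * k + 4) '' gapLists (3 * k + 8) := by
  rw [show gapLists (3 * k + 8) = {l | ((3 * k + 4) :: l).IsChain GapCondition} from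
    (tails_one_mod (k + 1)).symm]
  ext l
  cases l with
  | nil => simp [nil_mem_gapLists]
  | cons a l =>
    have h : GapCondition (3 * k + 2) a ↔ 3 * k + 6 ≤ a ∨ a = 3 * k + 4 := by
      unfold GapCondition; omega
    simp only [Set.mem_union, cons_mem_gapLists, Set.mem_image, Set.mem_ofPred_eq, List.cons.injEq,
      List.isChain_cons_cons, h]
    constructor
    · rintro ⟨h | rfl, hl⟩
      · exact Or.inl ⟨h, hl⟩
      · exact Or.inr ⟨l, hl, rfl, rfl⟩
    · rintro (⟨h, hl⟩ | ⟨t, ht, rfl, rfl⟩)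
      · exact ⟨Or.inl h, hl⟩
      · exact ⟨Or.inr rfl, ht⟩

/-! ### Recurrences for the gap lists -/

theorem listGenFun_gapLists_eq (s : ℕ) :
    listGenFun (gapLists s) = listGenFun (gapLists (s + 1)) +
      x * q ^ s * listGenFun {l | (s :: l).IsChain GapCondition} := by
  conv_lhs => rw [gapLists_eq_union]
  rw [listGenFun_union (disjoint_gapLists_cons_image (Nat.lt_succ_self s) _),
    listGenFun_cons_image]

theorem listGenFun_gapLists_zero_mod (k : ℕ) :
    listGenFun (gapLists (3 * k + 3)) = listGenFun (gapLists (3 * k + 5)) +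
      x * q ^ (3 * k + 4) * listGenFun (gapLists (3 * k + 8)) +
      x * q ^ (3 * k + 3) * listGenFun (gapLists (3 * k + 6)) := by
  rw [listGenFun_gapLists_eq, tails_zero_mod, listGenFun_gapLists_eq (3 * k + 3 + 1),
    show 3 * k + 3 + 1 = 3 * (k + 1) + 1 by ring, tails_one_mod]
  ring_nf

theorem listGenFun_gapLists_two_mod (k : ℕ) :
    listGenFun (gapLists (3 * k + 2)) = listGenFun (gapLists (3 * k + 3)) +
      x * q ^ (3 * k + 2) * listGenFun (gapLists (3 * k + 6)) +
      x ^ 2 * q ^ (6 * k + 6) * listGenFun (gapLists (3 * k + 8)) := by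
  rw [listGenFun_gapLists_eq, tails_two_mod,
    listGenFun_union (disjoint_gapLists_cons_image (by omega) _), listGenFun_cons_image]
  ring

theorem q_pow_dvd_iff {n : ℕ} {f : MvPowerSeries (Fin 2) ℤ} :
    q ^ n ∣ f ↔ ∀ d : Fin 2 →₀ ℕ, d 0 < n → coeff d f = 0 := X_pow_dvd_iff

theorem q_pow_dvd_listGenFun_gapLists_sub_one (s : ℕ) :
    q ^ s ∣ listGenFun (gapLists s) - 1 := by
  rw [q_pow_dvd_iff]
  intro d hd
  have hnil : ∀ l ∈ listFiber (gapLists s) (d 0) (d 1), l = [] := by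
    rintro (_ | ⟨a, l⟩) ⟨hl, hs, -⟩
    · rfl
    · have := (cons_mem_gapLists.1 hl).1
      simp only [List.sum_cons] at hs
      omega
  rw [map_sub, sub_eq_zero, coeff_one, listGenFun, coeff_genFun]
  split_ifs with h
  · subst h
    rw [(Set.ncard_eq_one (s := listFiber _ _ _)).2 ⟨[], ?_⟩, Nat.cast_one]
    exact Set.Subset.antisymm hnil (by simp [listFiber, nil_mem_gapLists])
  · rw [Nat.cast_eq_zero, Set.ncard_eq_zero (finite_listFiber _ _ _)]
    refine Set.eq_empty_of_forall_notMem fun l hl => h ?_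
    obtain rfl := hnil l hl
    obtain ⟨-, h0, h1⟩ := hl
    ext i
    fin_cases i
    · simpa using h0.symm
    · simpa using h1.symm

/-! ### Partitions as lists -/

theorem pairwise_le_of_isChain {l : List ℕ} (h : l.IsChain GapCondition) : l.Pairwise (· ≤ ·) :=
  List.isChain_iff_pairwise.1 (h.imp fun _ _ hab => by have := hab.1; omega)

/-- Sorting is a bijection here: a chain for the gap condition is already increasing, so it is its
own sorted form. -/
theorem card_filter_partitions₂ (P : Multiset ℕ → Prop) [DecidablePred P] (n m : ℕ) :
    {p ∈ partitions₂ n m | P p.parts}.card =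
      (listFiber {l | (0 ∉ l ∧ 2 ∉ l ∧ P l) ∧ l.IsChain GapCondition} n m).ncard := by
  rw [← Set.ncard_coe_finset]
  refine Set.ncard_congr (fun p _ => p.parts.sort (· ≤ ·)) ?_ ?_ ?_
  · rintro p hp
    simp only [partitions₂, Finset.mem_filter, Finset.mem_univ, true_and, Finset.coe_filter,
      Set.mem_ofPred_eq] at hp
    obtain ⟨⟨h1, h2, h3⟩, h4⟩ := hp
    refine ⟨⟨⟨?_, ?_, ?_⟩, h3⟩, ?_, ?_⟩
    · rw [Multiset.mem_sort]
      exact fun h => (p.parts_pos h).false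
    · rwa [Multiset.mem_sort]
    · rwa [Multiset.sort_eq]
    · rw [← Multiset.sum_coe, Multiset.sort_eq, p.parts_sum]
    · rw [Multiset.length_sort, h1]
  · intro p p' _ _ h
    ext1
    rw [← Multiset.sort_eq p.parts (· ≤ ·), h, Multiset.sort_eq]
  · rintro l ⟨⟨⟨h0, h2, hP⟩, hc⟩, hs, hl⟩
    have hsort : (l : Multiset ℕ).sort (· ≤ ·) = l := by
      rw [Multiset.coe_sort]
      exact List.mergeSort_of_pairwise (by simpa using pairwise_le_of_isChain hc)
    refine ⟨⟨l, fun {i} hi => Nat.pos_of_ne_zero fun h => h0 (h ▸ hi), by simpa using hs⟩, ?_, ?_⟩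
    · simp [partitions₂, hsort, hc, hl, h2, hP]
    · exact hsort

theorem genFun_cp₂WithoutOne : genFun cp₂WithoutOne = listGenFun (gapLists 3) := by
  have h : {l : List ℕ | (0 ∉ l ∧ 2 ∉ l ∧ 1 ∉ (l : Multiset ℕ)) ∧ l.IsChain GapCondition} =
      gapLists 3 := by
    ext l
    simp only [Set.mem_ofPred_eq, gapLists, Multiset.mem_coe]
    rw [and_comm, and_congr_right_iff]
    intro hc
    cases l with
    | nil => simp
    | cons a l =>
      have hp := (List.pairwise_cons.1 (pairwise_le_of_isChain hc)).1
      simp only [List.head?_cons, Option.mem_some_iff, forall_eq', List.mem_cons, not_or]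
      constructor
      · omega
      · intro ha
        refine ⟨⟨by omega, fun h => ?_⟩, ⟨by omega, fun h => ?_⟩, ⟨by omega, fun h => ?_⟩⟩ <;>
        · have := hp _ h
          omega
  rw [listGenFun, ← h]
  congr 1
  ext n m
  exact card_filter_partitions₂ (1 ∉ ·) n m

theorem genFun_cp₂WithOne : genFun cp₂WithOne = x * q * listGenFun (gapLists 5) := by
  have h : {l : List ℕ | (0 ∉ l ∧ 2 ∉ l ∧ 1 ∈ (l : Multiset ℕ)) ∧ l.IsChain GapCondition} =
      List.cons 1 '' gapLists 5 := by
    rw [← tails_one_mod 0]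
    ext l
    simp only [Set.mem_ofPred_eq, Multiset.mem_coe, Set.mem_image]
    constructor
    · rintro ⟨⟨h0, h2, h1⟩, hc⟩
      cases l with
      | nil => simp at h1
      | cons a l =>
        have hp := (List.pairwise_cons.1 (pairwise_le_of_isChain hc)).1
        have ha : a = 1 := by
          rcases List.mem_cons.1 h1 with h | h
          · exact h.symm
          · have := hp 1 h
            have : a ≠ 0 := fun h => h0 (by simp [h])
            omega
        subst ha
        exact ⟨l, hc, rfl⟩
    · rintro ⟨t, ht, rfl⟩
      refine ⟨?_, ht⟩
      cases t with
      | nil => simp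
      | cons b t =>
        have hb := (List.isChain_cons_cons.1 ht).1
        have hp := (List.pairwise_cons.1 (pairwise_le_of_isChain
          (List.isChain_cons_cons.1 ht).2)).1
        have h3 := hb.1
        simp only [List.mem_cons, not_or]
        refine ⟨⟨by omega, by omega, fun h => ?_⟩, ⟨by omega, by omega, fun h => ?_⟩,
          Or.inl trivial⟩ <;>
        · have := hp _ h
          omega
  have hx := listGenFun_cons_image 1 (gapLists 5)
  rw [pow_one] at hx
  rw [← hx, listGenFun, ← h]
  congr 1
  ext n m
  exact card_filter_partitions₂ (1 ∈ ·) n m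

theorem genFun_cp₂ : genFun cp₂ = genFun cp₂WithoutOne + genFun cp₂WithOne := by
  ext d
  rw [map_add, coeff_genFun, coeff_genFun, coeff_genFun, ← Nat.cast_add, cp₂, cp₂WithoutOne,
    cp₂WithOne, add_comm, Finset.card_filter_add_card_filter_not]

/-! ### Uniqueness of the solution of the `q`-difference equations -/

theorem eq_zero_of_forall_q_pow_dvd {f : MvPowerSeries (Fin 2) ℤ} (h : ∀ n, q ^ n ∣ f) : f = 0 := by
  ext d
  simpa using q_pow_dvd_iff.1 (h (d 0 + 1)) d (Nat.lt_succ_self _)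

/-- The only solution of the homogeneous system with `q ^ k` dividing `B k` is zero. -/
theorem eq_zero_of_q_difference {B C : ℕ → MvPowerSeries (Fin 2) ℤ}
    (hdvd : ∀ k, q ^ k ∣ B k)
    (hB : ∀ k, B k = C k + x * q ^ (3 * k + 2) * C (k + 1) + x ^ 2 * q ^ (6 * k + 6) * B (k + 2))
    (hC : ∀ k, C k = B (k + 1) + x * q ^ (3 * k + 4) * B (k + 2) + x * q ^ (3 * k + 3) * C (k + 1))
    (k : ℕ) : B k = 0 ∧ C k = 0 := by
  -- If q^n divides everything, each term with an explicit power of q vanishes modulo q^(n+1). This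
  -- leaves B_k ≡ C_k ≡ B_{k+1}, and iterating reaches B_{k+n+1}, which `hdvd` kills.
  have key : ∀ n k, q ^ n ∣ B k ∧ q ^ n ∣ C k := by
    intro n
    induction n with
    | zero => simp
    | succ n ih =>
      have hmul : ∀ (y f : MvPowerSeries (Fin 2) ℤ) (e : ℕ), q ^ n ∣ f →
          q ^ (n + 1) ∣ y * q ^ (e + 1) * f := by
        rintro y _ e ⟨g, rfl⟩
        exact ⟨y * q ^ e * g, by ring⟩
      have hC' : ∀ k, q ^ (n + 1) ∣ B (k + 1) → q ^ (n + 1) ∣ C k := fun k h => by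
        rw [hC]
        exact dvd_add (dvd_add h (hmul _ _ _ (ih _).1)) (hmul _ _ _ (ih _).2)
      have hB' : ∀ k, q ^ (n + 1) ∣ B (k + 1) → q ^ (n + 1) ∣ B k := fun k h => by
        rw [hB]
        exact dvd_add (dvd_add (hC' k h) (hmul _ _ _ (ih _).2)) (hmul _ _ _ (ih _).1)
      have hdesc : ∀ j k, q ^ (n + 1) ∣ B (k + j) → q ^ (n + 1) ∣ B k := by
        intro j
        induction j with
        | zero => exact fun k h => h
        | succ j ihj => exact fun k h => ihj k (hB' _ h)
      have hall : ∀ k, q ^ (n + 1) ∣ B k := fun k =>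
        hdesc (n + 1) k ((pow_dvd_pow q (by omega)).trans (hdvd _))
      exact fun k => ⟨hall k, hC' k (hall _)⟩
  exact ⟨eq_zero_of_forall_q_pow_dvd fun n => (key n k).1,
    eq_zero_of_forall_q_pow_dvd fun n => (key n k).2⟩

/-! ### The double series -/

/-- The quadratic form in the exponent of `q`. -/
def quadForm (k : ℕ × ℕ) : ℕ := 6 * k.2 ^ 2 + 2 * k.1 ^ 2 + 6 * k.2 * k.1

/-- The summand of `doubleSeries a b`. -/
noncomputable def summand (a b : ℕ) (k : ℕ × ℕ) : MvPowerSeries (Fin 2) ℤ :=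
  overDenom (q ^ (quadForm k + a * k.2 + b * k.1) * x ^ (2 * k.2 + k.1)) k.1 k.2

/-- The double series `∑ q ^ (6 n₂² + 2 n₁² + 6 n₂ n₁ + a n₂ + b n₁) x ^ (2 n₂ + n₁)` over
`(q; q)_{n₁} (q³; q³)_{n₂}`. -/
noncomputable def doubleSeries (a b : ℕ) : MvPowerSeries (Fin 2) ℤ := ∑' k, summand a b k

theorem q_pow_dvd_summand (a b : ℕ) (k : ℕ × ℕ) :
    q ^ (quadForm k + a * k.2 + b * k.1) ∣ summand a b k :=
  (Dvd.intro _ rfl : _ ∣ q ^ (quadForm k + a * k.2 + b * k.1) * x ^ (2 * k.2 + k.1)).mul_right _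

theorem summable_summand (a b : ℕ) : Summable (summand a b) := by
  rw [WithPiTopology.summable_iff_summable_coeff]
  intro d
  refine summable_of_ne_finset_zero (s := Finset.range (d 0 + 1) ×ˢ Finset.range (d 0 + 1)) ?_
  rintro ⟨i, j⟩ hk
  refine q_pow_dvd_iff.1 (q_pow_dvd_summand a b _) d ?_
  simp only [Finset.mem_product, Finset.mem_range, not_and_or, not_lt] at hk
  -- The exponent of q is at least max(i, j), so only finitely many terms reach a given coefficient.
  have h1 : i ≤ i ^ 2 := Nat.le_self_pow two_ne_zero i
  have h2 : j ≤ j ^ 2 := Nat.le_self_pow two_ne_zero j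
  simp only [quadForm]
  omega

theorem hasSum_doubleSeries (a b : ℕ) : HasSum (summand a b) (doubleSeries a b) :=
  (summable_summand a b).hasSum

theorem summand_zero (a b : ℕ) : summand a b (0, 0) = 1 := by
  simp [summand, quadForm, overDenom, denom, qPochhammer]

/-- The least exponents with n₁ = 0 < n₂ and with n₁ > 0 are a+6 and b+2. -/
theorem q_pow_dvd_doubleSeries_sub_one {a b n : ℕ} (ha : n ≤ a + 6) (hb : n ≤ b + 2) :
    q ^ n ∣ doubleSeries a b - 1 := by
  rw [q_pow_dvd_iff]
  intro d hd
  have h := WithPiTopology.hasSum_iff_hasSum_coeff.1 (hasSum_doubleSeries a b) d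
  have h' := hasSum_single (f := fun k => coeff d (summand a b k)) (0, 0) (by
    rintro ⟨i, j⟩ hk
    refine q_pow_dvd_iff.1 (q_pow_dvd_summand a b _) d (hd.trans_le ?_)
    simp only [quadForm]
    rcases Nat.eq_zero_or_pos i with rfl | hi
    · have hj : 1 ≤ j := Nat.pos_of_ne_zero fun h => hk (by rw [h])
      have h1 := Nat.mul_le_mul_left a hj
      have h2 : 1 ≤ j ^ 2 := Nat.one_le_pow _ _ hj
      omega
    · have h1 := Nat.mul_le_mul_left b hi
      have h2 : 1 ≤ i ^ 2 := Nat.one_le_pow _ _ hi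
      omega)
  rw [map_sub, h.unique h', summand_zero, sub_self]

theorem qPochhammer_succ {R : Type*} [CommRing R] (a b : R) (n : ℕ) :
    qPochhammer a b (n + 1) = qPochhammer a b n * (1 - a * b ^ n) :=
  Finset.prod_range_succ _ _

theorem overDenom_eq_iff {f g : MvPowerSeries (Fin 2) ℤ} {i j : ℕ} :
    overDenom f i j = g ↔ f = g * denom i j := by
  constructor
  · rintro rfl
    exact (Ring.inverse_mul_cancel_right _ _ (isUnit_denom i j)).symm
  · rintro rfl
    exact Ring.mul_inverse_cancel_right _ _ (isUnit_denom i j)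

theorem overDenom_mul_denom (f : MvPowerSeries (Fin 2) ℤ) (i j : ℕ) :
    overDenom f i j * denom i j = f := (overDenom_eq_iff.1 rfl).symm

theorem mul_overDenom (f g : MvPowerSeries (Fin 2) ℤ) (i j : ℕ) :
    f * overDenom g i j = overDenom (f * g) i j := (mul_assoc _ _ _).symm

theorem overDenom_add (f g : MvPowerSeries (Fin 2) ℤ) (i j : ℕ) :
    overDenom (f + g) i j = overDenom f i j + overDenom g i j := add_mul _ _ _

theorem overDenom_succ_left (f : MvPowerSeries (Fin 2) ℤ) (i j : ℕ) :
    overDenom (f * (1 - q ^ (i + 1))) (i + 1) j = overDenom f i j := by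
  rw [overDenom_eq_iff, denom, qPochhammer_succ, ← pow_succ']
  conv_lhs => rw [← overDenom_mul_denom f i j, denom]
  ring

theorem overDenom_succ_right (f : MvPowerSeries (Fin 2) ℤ) (i j : ℕ) :
    overDenom (f * (1 - q ^ (3 * (j + 1)))) i (j + 1) = overDenom f i j := by
  rw [overDenom_eq_iff, denom, qPochhammer_succ, ← pow_succ', ← pow_mul]
  conv_lhs => rw [← overDenom_mul_denom f i j, denom]
  ring

/-- The difference carries a factor 1 - q^(n₁), which cancels the last factor of (q;q)_{n₁};
expanding the quadratic form at n₁ = i+1 shifts a by 6 and b by 4. -/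
theorem summand_sub_left (a b : ℕ) (i j : ℕ) :
    summand a b (i + 1, j) - summand a (b + 1) (i + 1, j) =
      x * q ^ (b + 2) * summand (a + 6) (b + 4) (i, j) := by
  rw [summand, summand, summand, mul_overDenom, sub_eq_iff_eq_add,
    ← overDenom_succ_left (x * q ^ (b + 2) * _), ← overDenom_add]
  congr 1
  simp only [quadForm]
  ring

theorem summand_sub_right (a b : ℕ) (i j : ℕ) :
    summand a b (i, j + 1) - summand (a + 3) b (i, j + 1) =
      x ^ 2 * q ^ (a + 6) * summand (a + 12) (b + 6) (i, j) := by
  rw [summand, summand, summand, mul_overDenom, sub_eq_iff_eq_add,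
    ← overDenom_succ_right (x ^ 2 * q ^ (a + 6) * _), ← overDenom_add]
  congr 1
  simp only [quadForm]
  ring

theorem doubleSeries_left (a b : ℕ) :
    doubleSeries a b = doubleSeries a (b + 1) + x * q ^ (b + 2) * doubleSeries (a + 6) (b + 4) := by
  have hinj : Function.Injective fun k : ℕ × ℕ => (k.1 + 1, k.2) := by
    rintro ⟨i, j⟩ ⟨i', j'⟩ h
    simpa using h
  have h1 := (hasSum_doubleSeries a b).sub (hasSum_doubleSeries a (b + 1))
  rw [← hinj.hasSum_iff] at h1
  · rw [← sub_eq_iff_eq_add']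
    have h2 := (hasSum_doubleSeries (a + 6) (b + 4)).mul_left (x * q ^ (b + 2))
    rw [← funext fun k : ℕ × ℕ => summand_sub_left a b k.1 k.2] at h2
    exact h1.unique h2
  -- The shift misses only n₁ = 0, where the two summands coincide.
  · rintro ⟨_ | i, j⟩ hk
    · simp [summand]
    · exact (hk (Set.mem_range_self (i, j))).elim

theorem doubleSeries_right (a b : ℕ) :
    doubleSeries a b =
      doubleSeries (a + 3) b + x ^ 2 * q ^ (a + 6) * doubleSeries (a + 12) (b + 6) := by
  have hinj : Function.Injective fun k : ℕ × ℕ => (k.1, k.2 + 1) := by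
    rintro ⟨i, j⟩ ⟨i', j'⟩ h
    simpa using h
  have h1 := (hasSum_doubleSeries a b).sub (hasSum_doubleSeries (a + 3) b)
  rw [← hinj.hasSum_iff] at h1
  · rw [← sub_eq_iff_eq_add']
    have h2 := (hasSum_doubleSeries (a + 12) (b + 6)).mul_left (x ^ 2 * q ^ (a + 6))
    rw [← funext fun k : ℕ × ℕ => summand_sub_right a b k.1 k.2] at h2
    exact h1.unique h2
  · rintro ⟨i, _ | j⟩ hk
    · simp [summand]
    · exact (hk (Set.mem_range_self (i, j))).elim

theorem doubleSeries_two_mod (k : ℕ) :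
    doubleSeries (6 * k) (3 * k) = doubleSeries (6 * k + 3) (3 * k + 1) +
      x * q ^ (3 * k + 2) * doubleSeries (6 * (k + 1) + 3) (3 * (k + 1) + 1) +
      x ^ 2 * q ^ (6 * k + 6) * doubleSeries (6 * (k + 2)) (3 * (k + 2)) := by
  rw [doubleSeries_right, doubleSeries_left (6 * k + 3)]
  ring_nf

theorem doubleSeries_zero_mod (k : ℕ) :
    doubleSeries (6 * k + 3) (3 * k + 1) = doubleSeries (6 * (k + 1)) (3 * (k + 1)) +
      x * q ^ (3 * k + 4) * doubleSeries (6 * (k + 2)) (3 * (k + 2)) +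
      x * q ^ (3 * k + 3) * doubleSeries (6 * (k + 1) + 3) (3 * (k + 1) + 1) := by
  have h1 := doubleSeries_left (6 * k + 3) (3 * k + 1)
  have h2 := doubleSeries_left (6 * k + 3) (3 * k + 2)
  have h3 := doubleSeries_right (6 * k + 3) (3 * k + 3)
  have h4 := doubleSeries_left (6 * k + 9) (3 * k + 4)
  have h5 := doubleSeries_right (6 * k + 9) (3 * k + 6)
  have h6 := doubleSeries_left (6 * k + 15) (3 * k + 8)
  simp only [mul_add, add_assoc, Nat.reduceAdd, Nat.reduceMul] at *
  -- `h1`, `h2`, `h3` raise (a,b) from (6k+3,3k+1) to (6k+6,3k+3); the other three cancel the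
  -- surplus x² and x³ terms.
  linear_combination h1 + h2 + h3 - x * q ^ (3 * k + 3) * h4 + x * q ^ (3 * k + 4) * h5 -
    x ^ 2 * q ^ (6 * k + 9) * h6

/-! ### Identification of the two solutions -/

theorem listGenFun_gapLists_eq_doubleSeries (k : ℕ) :
    listGenFun (gapLists (3 * k + 2)) = doubleSeries (6 * k) (3 * k) ∧
      listGenFun (gapLists (3 * k + 3)) = doubleSeries (6 * k + 3) (3 * k + 1) := by
  have h := eq_zero_of_q_difference
    (B := fun k => listGenFun (gapLists (3 * k + 2)) - doubleSeries (6 * k) (3 * k))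
    (C := fun k => listGenFun (gapLists (3 * k + 3)) - doubleSeries (6 * k + 3) (3 * k + 1))
    (fun k => by
      have h1 := (pow_dvd_pow q (show k ≤ 3 * k + 2 by omega)).trans
        (q_pow_dvd_listGenFun_gapLists_sub_one (3 * k + 2))
      have h2 : q ^ k ∣ doubleSeries (6 * k) (3 * k) - 1 :=
        q_pow_dvd_doubleSeries_sub_one (by omega) (by omega)
      simpa using dvd_sub h1 h2)
    (fun k => by
      rw [listGenFun_gapLists_two_mod, doubleSeries_two_mod]
      simp only [mul_add, add_assoc, Nat.reduceAdd, Nat.reduceMul]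
      ring)
    (fun k => by
      rw [listGenFun_gapLists_zero_mod, doubleSeries_zero_mod]
      simp only [mul_add, add_assoc, Nat.reduceAdd, Nat.reduceMul]
      ring) k
  exact ⟨sub_eq_zero.1 h.1, sub_eq_zero.1 h.2⟩

theorem hasSum_cp₂WithoutOne :
    HasSum
      (fun k : ℕ × ℕ => overDenom
        (q ^ (6 * k.2 ^ 2 + 3 * k.2 + 2 * k.1 ^ 2 + k.1 + 6 * k.2 * k.1) *
          x ^ (2 * k.2 + k.1)) k.1 k.2)
      (genFun cp₂WithoutOne) := by
  rw [genFun_cp₂WithoutOne, (listGenFun_gapLists_eq_doubleSeries 0).2]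
  convert hasSum_doubleSeries 3 1 using 1
  funext k
  rw [summand, quadForm]
  ring_nf

theorem hasSum_cp₂WithOne :
    HasSum
      (fun k : ℕ × ℕ => overDenom
        (q ^ (6 * k.2 ^ 2 + 3 * k.2 + 2 * k.1 ^ 2 + k.1 + 6 * k.2 * k.1) *
          (x * q ^ (3 * k.2 + 2 * k.1 + 1)) * x ^ (2 * k.2 + k.1)) k.1 k.2)
      (genFun cp₂WithOne) := by
  rw [genFun_cp₂WithOne, (listGenFun_gapLists_eq_doubleSeries 1).1]
  have h := (hasSum_doubleSeries 6 3).mul_left (x * q)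
  refine (congrArg (HasSum · _) (funext fun k => ?_)).mpr h
  rw [summand, quadForm, mul_overDenom]
  congr 1
  -- The exponents match since 1 + 6n₂ + 3n₁ = (3n₂ + n₁) + (3n₂ + 2n₁ + 1).
  ring

end Capparelli

theorem mainTheorem2 :
    HasSum
      (fun k : ℕ × ℕ => overDenom
        (q ^ (6 * k.2 ^ 2 + 3 * k.2 + 2 * k.1 ^ 2 + k.1 + 6 * k.2 * k.1) *
          (1 + x * q ^ (3 * k.2 + 2 * k.1 + 1)) * x ^ (2 * k.2 + k.1)) k.1 k.2)
      (genFun cp₂) ∧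
    HasSum
      (fun k : ℕ × ℕ => overDenom
        (q ^ (6 * k.2 ^ 2 + 3 * k.2 + 2 * k.1 ^ 2 + k.1 + 6 * k.2 * k.1) *
          x ^ (2 * k.2 + k.1)) k.1 k.2)
      (genFun cp₂WithoutOne) ∧
    HasSum
      (fun k : ℕ × ℕ => overDenom
        (q ^ (6 * k.2 ^ 2 + 3 * k.2 + 2 * k.1 ^ 2 + k.1 + 6 * k.2 * k.1) *
          (x * q ^ (3 * k.2 + 2 * k.1 + 1)) * x ^ (2 * k.2 + k.1)) k.1 k.2)
      (genFun cp₂WithOne) := by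
  refine ⟨?_, hasSum_cp₂WithoutOne, hasSum_cp₂WithOne⟩
  rw [genFun_cp₂]
  convert hasSum_cp₂WithoutOne.add hasSum_cp₂WithOne using 1
  funext k
  rw [← overDenom_add]
  congr 1
  ring
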